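/- Let $\mathcal{X}$ and $\mathcal{A}$ be (strict) 2-categories with small hom-categories $Mor(-,-)$, and let $F:\mathcal{X}\to\mathcal{A}$ and $G:\mathcal{A}\to\mathcal{X}$ be pseudo functors (all coherence 2-cells of pseudo functors and of pseudo natural transformations are invertible). Call $F$ a \emph{left biadjoint} for $G$ if there is a pseudo natural transformation $$\phi: Mor_{\mathcal{A}}\circ(F^{op}\times 1_{\mathcal{A}})\Rightarrow Mor_{\mathcal{X}}\circ(1_{\mathcal{X}^{op}}\times G)$$ between pseudo functors $\mathcal{X}^{op}\times\mathcal{A}\to Cat$ (where $op$ reverses the 1-cells only) such that each component $\phi_{X,A}:Mor_{\mathcal{A}}(FX,A)\to Mor_{\mathcal{X}}(X,GA)$ is an equivalence of categories. Call a morphism $u:X\to GR$, with $X\in\mathcal{X}$ and $R\in\mathcal{A}$, a \emph{biuniversal arrow} from $X$ to $G$ if for every object $A$ of $\mathcal{A}$ the functor $$Mor_{\mathcal{A}}(R,A)\to Mor_{\mathcal{X}}(X,GA),\qquad f\mapsto Gf\circ u,\quad \gamma\mapsto G\gamma * i_u$$ is an equivalence of categories. Then $F$ is a left biadjoint for $G$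 if and only if there exists a pseudo natural transformation $\eta:1_{\mathcal{X}}\Rightarrow GF$ such that $\eta_X:X\to G(FX)$ is a biuniversal arrow from $X$ to $G$ for every object $X$ of $\mathcal{X}$. -/

import Mathlib

universe w v u₁ u₂

namespace Biadj

open CategoryTheory Bicategory Opposite Bicategory.Opposite

universe w₁ w₂ w₃ w₄ v₁ v₂ v₃ v₄ u u₃ u₄

section Op

variable {B : Type u₁} [Bicategory.{w₁, v₁} B] {C : Type u₂} [Bicategory.{w₂, v₂} C]

theorem op_associator (F : B ⥤ᵖ C) {a b c d : B} (f : a ⟶ b) (g : b ⟶ c) (h : c ⟶ d) :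
    F.map₂ (α_ f g h).inv =
      (F.mapComp f (g ≫ h)).hom ≫ F.map f ◁ (F.mapComp g h).hom ≫
        (α_ (F.map f) (F.map g) (F.map h)).inv ≫ (F.mapComp f g).inv ▷ F.map h ≫
          (F.mapComp (f ≫ g) h).inv := by
  rw [Pseudofunctor.mapComp_assoc_right_hom_assoc]
  simp

/-- The pseudofunctor `Fᵒᵖ : Bᵒᵖ ⥤ᵖ Cᵒᵖ` induced by `F : B ⥤ᵖ C` on the bicategories obtained by
reversing 1-cells only. -/
def opPseudofunctor (F : B ⥤ᵖ C) : Bᵒᵖ ⥤ᵖ Cᵒᵖ where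
  obj b := op (F.obj b.unop)
  map f := (F.map f.unop).op
  map₂ η := op2 (F.map₂ η.unop2)
  map₂_id f := congrArg op2 (F.map₂_id f.unop)
  map₂_comp η θ := congrArg op2 (F.map₂_comp η.unop2 θ.unop2)
  mapId b := (F.mapId b.unop).op2
  mapComp f g := (F.mapComp g.unop f.unop).op2
  map₂_whisker_left f _ _ η := congrArg op2 (F.map₂_whisker_right η.unop2 f.unop)
  map₂_whisker_right η h := congrArg op2 (F.map₂_whisker_left h.unop η.unop2)
  map₂_associator f g h := by
    refine congrArg op2 (op_associator F h.unop g.unop f.unop)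
  map₂_left_unitor f := congrArg op2 (F.map₂_right_unitor f.unop)
  map₂_right_unitor f := congrArg op2 (F.map₂_left_unitor f.unop)

end Op

section Prod

variable {B : Type u₁} [Bicategory.{w₁, v₁} B] {C : Type u₂} [Bicategory.{w₂, v₂} C]
variable {B' : Type u₃} [Bicategory.{w₃, v₃} B'] {C' : Type u₄} [Bicategory.{w₄, v₄} C']

/-- The product `F × F'` of two pseudofunctors. -/
def prodPseudofunctor (F : B ⥤ᵖ C) (F' : B' ⥤ᵖ C') : (B × B') ⥤ᵖ (C × C') where
  obj b := (F.obj b.1, F'.obj b.2)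
  map f := (F.map f.1, F'.map f.2)
  map₂ η := (F.map₂ η.1, F'.map₂ η.2)
  map₂_id f := Prod.ext (F.map₂_id f.1) (F'.map₂_id f.2)
  map₂_comp η θ := Prod.ext (F.map₂_comp η.1 θ.1) (F'.map₂_comp η.2 θ.2)
  mapId b := Iso.prod (F.mapId b.1) (F'.mapId b.2)
  mapComp f g := Iso.prod (F.mapComp f.1 g.1) (F'.mapComp f.2 g.2)
  map₂_whisker_left f _ _ η :=
    Prod.ext (F.map₂_whisker_left f.1 η.1) (F'.map₂_whisker_left f.2 η.2)
  map₂_whisker_right η h :=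
    Prod.ext (F.map₂_whisker_right η.1 h.1) (F'.map₂_whisker_right η.2 h.2)
  map₂_associator f g h :=
    Prod.ext (F.map₂_associator f.1 g.1 h.1) (F'.map₂_associator f.2 g.2 h.2)
  map₂_left_unitor f := Prod.ext (F.map₂_left_unitor f.1) (F'.map₂_left_unitor f.2)
  map₂_right_unitor f := Prod.ext (F.map₂_right_unitor f.1) (F'.map₂_right_unitor f.2)

end Prod

section Mor

variable {B : Type u} [Bicategory.{w, v} B]

theorem mor_nat {a a' b b' : B} {f f' : a' ⟶ a} {g g' : b ⟶ b'} (η : f ⟶ f') (θ : g ⟶ g')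
    {h k : a ⟶ b} (β : h ⟶ k) :
    f ◁ β ▷ g ≫ η ▷ (k ≫ g) ≫ f' ◁ k ◁ θ = (η ▷ (h ≫ g) ≫ f' ◁ h ◁ θ) ≫ f' ◁ β ▷ g' := by
  rw [whisker_exchange_assoc, Category.assoc, ← whiskerLeft_comp, ← whiskerLeft_comp,
    whisker_exchange]

theorem mor_id_nat {a b : B} {h k : a ⟶ b} (β : h ⟶ k) :
    𝟙 a ◁ β ▷ 𝟙 b ≫ (λ_ (k ≫ 𝟙 b)).hom ≫ (ρ_ k).hom =
      ((λ_ (h ≫ 𝟙 b)).hom ≫ (ρ_ h).hom) ≫ β := by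
  bicategory

theorem mor_comp_nat {a a' a'' b b' b'' : B} (f : a' ⟶ a) (g : b ⟶ b') (f' : a'' ⟶ a')
    (g' : b' ⟶ b'') {h k : a ⟶ b} (β : h ⟶ k) :
    (f' ≫ f) ◁ β ▷ (g ≫ g') ≫ (α_ f' f (k ≫ g ≫ g')).hom ≫
        f' ◁ (f ◁ (α_ k g g').inv ≫ (α_ f (k ≫ g) g').inv) =
      ((α_ f' f (h ≫ g ≫ g')).hom ≫ f' ◁ (f ◁ (α_ h g g').inv ≫ (α_ f (h ≫ g) g').inv)) ≫
        f' ◁ (f ◁ β ▷ g) ▷ g' := by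
  simp

theorem mor_map₂_id {a a' b b' : B} (f : a' ⟶ a) (g : b ⟶ b') (h : a ⟶ b) :
    𝟙 f ▷ (h ≫ g) ≫ f ◁ h ◁ 𝟙 g = 𝟙 (f ≫ h ≫ g) := by
  rw [id_whiskerRight, whiskerLeft_id, whiskerLeft_id, Category.comp_id]

theorem mor_map₂_comp {a a' b b' : B} {f f' f'' : a' ⟶ a} {g g' g'' : b ⟶ b'} (η : f ⟶ f')
    (η' : f' ⟶ f'') (θ : g ⟶ g') (θ' : g' ⟶ g'') (h : a ⟶ b) :
    (η ≫ η') ▷ (h ≫ g) ≫ f'' ◁ h ◁ (θ ≫ θ') =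
      (η ▷ (h ≫ g) ≫ f' ◁ h ◁ θ) ≫ η' ▷ (h ≫ g') ≫ f'' ◁ h ◁ θ' := by
  rw [comp_whiskerRight, whiskerLeft_comp, whiskerLeft_comp, Category.assoc, Category.assoc,
    whisker_exchange_assoc]

theorem mor_whisker_left {a a' a'' b b' b'' : B} (f : a' ⟶ a) (g : b ⟶ b') {f' f'' : a'' ⟶ a'}
    {g' g'' : b' ⟶ b''} (η : f' ⟶ f'') (θ : g' ⟶ g'') (h : a ⟶ b) :
    (η ▷ f) ▷ (h ≫ g ≫ g') ≫ (f'' ≫ f) ◁ h ◁ g ◁ θ =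
      ((α_ f' f (h ≫ g ≫ g')).hom ≫ f' ◁ (f ◁ (α_ h g g').inv ≫ (α_ f (h ≫ g) g').inv)) ≫
        (η ▷ ((f ≫ h ≫ g) ≫ g') ≫ f'' ◁ (f ≫ h ≫ g) ◁ θ) ≫
        (f'' ◁ ((α_ f (h ≫ g) g'').hom ≫ f ◁ (α_ h g g'').hom) ≫
          (α_ f'' f (h ≫ g ≫ g'')).inv) := by
  bicategory

theorem mor_whisker_right {a a' a'' b b' b'' : B} {f f' : a' ⟶ a} {g g' : b ⟶ b'} (η : f ⟶ f')
    (θ : g ⟶ g') (k : a'' ⟶ a') (l : b' ⟶ b'') (h : a ⟶ b) :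
    (k ◁ η) ▷ (h ≫ g ≫ l) ≫ (k ≫ f') ◁ h ◁ (θ ▷ l) =
      ((α_ k f (h ≫ g ≫ l)).hom ≫ k ◁ (f ◁ (α_ h g l).inv ≫ (α_ f (h ≫ g) l).inv)) ≫
        (k ◁ (η ▷ (h ≫ g) ≫ f' ◁ h ◁ θ) ▷ l) ≫
        (k ◁ ((α_ f' (h ≫ g') l).hom ≫ f' ◁ (α_ h g' l).hom) ≫
          (α_ k f' (h ≫ g' ≫ l)).inv) := by
  bicategory

theorem mor_assoc {a₀ a₁ a₂ a₃ b₀ b₁ b₂ b₃ : B} (f : a₁ ⟶ a₀) (f' : a₂ ⟶ a₁) (f'' : a₃ ⟶ a₂)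
    (g : b₀ ⟶ b₁) (g' : b₁ ⟶ b₂) (g'' : b₂ ⟶ b₃) (h : a₀ ⟶ b₀) :
    (α_ f'' f' f).inv ▷ (h ≫ (g ≫ g') ≫ g'') ≫ ((f'' ≫ f') ≫ f) ◁ h ◁ (α_ g g' g'').hom =
      ((α_ f'' (f' ≫ f) (h ≫ (g ≫ g') ≫ g'')).hom ≫
        f'' ◁ ((f' ≫ f) ◁ (α_ h (g ≫ g') g'').inv ≫ (α_ (f' ≫ f) (h ≫ g ≫ g') g'').inv)) ≫
      (f'' ◁ ((α_ f' f (h ≫ g ≫ g')).hom ≫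
        f' ◁ (f ◁ (α_ h g g').inv ≫ (α_ f (h ≫ g) g').inv)) ▷ g'') ≫
      𝟙 _ ≫
      (f'' ◁ ((α_ f' ((f ≫ h ≫ g) ≫ g') g'').hom ≫ f' ◁ (α_ (f ≫ h ≫ g) g' g'').hom) ≫
        (α_ f'' f' ((f ≫ h ≫ g) ≫ g' ≫ g'')).inv) ≫
      ((f'' ≫ f') ◁ ((α_ f (h ≫ g) (g' ≫ g'')).hom ≫ f ◁ (α_ h g (g' ≫ g'')).hom) ≫
        (α_ (f'' ≫ f') f (h ≫ g ≫ g' ≫ g'')).inv) := by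
  bicategory

theorem mor_left_unitor {a a' b b' : B} (f : a' ⟶ a) (g : b ⟶ b') (h : a ⟶ b) :
    (ρ_ f).hom ▷ (h ≫ 𝟙 b ≫ g) ≫ f ◁ h ◁ (λ_ g).hom =
      ((α_ f (𝟙 a) (h ≫ 𝟙 b ≫ g)).hom ≫
        f ◁ (𝟙 a ◁ (α_ h (𝟙 b) g).inv ≫ (α_ (𝟙 a) (h ≫ 𝟙 b) g).inv)) ≫
      (f ◁ ((λ_ (h ≫ 𝟙 b)).hom ≫ (ρ_ h).hom) ▷ g) ≫ 𝟙 _ := by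
  bicategory

theorem mor_right_unitor {a a' b b' : B} (f : a' ⟶ a) (g : b ⟶ b') (h : a ⟶ b) :
    (λ_ f).hom ▷ (h ≫ g ≫ 𝟙 b') ≫ f ◁ h ◁ (ρ_ g).hom =
      ((α_ (𝟙 a') f (h ≫ g ≫ 𝟙 b')).hom ≫
        𝟙 a' ◁ (f ◁ (α_ h g (𝟙 b')).inv ≫ (α_ f (h ≫ g) (𝟙 b')).inv)) ≫
      ((λ_ ((f ≫ h ≫ g) ≫ 𝟙 b')).hom ≫ (ρ_ (f ≫ h ≫ g)).hom) ≫ 𝟙 _ := by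
  bicategory

/-- For 1-cells `f : a' ⟶ a` and `g : b ⟶ b'`, the functor `Mor(a, b) ⥤ Mor(a', b')` given by
`h ↦ f ≫ h ≫ g` on 1-cells and by whiskering on 2-cells. -/
@[simps]
def morMap {a a' b b' : B} (f : a' ⟶ a) (g : b ⟶ b') : (a ⟶ b) ⥤ (a' ⟶ b') where
  obj h := f ≫ h ≫ g
  map β := f ◁ β ▷ g

/-- For 2-cells `η : f ⟶ f'` and `θ : g ⟶ g'`, the natural transformation whose component at `h`
is the horizontal composite of `η`, the identity of `h`, and `θ`. -/
@[simps]
def morMap₂ {a a' b b' : B} {f f' : a' ⟶ a} {g g' : b ⟶ b'} (η : f ⟶ f') (θ : g ⟶ g') :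
    morMap f g ⟶ morMap f' g' where
  app h := η ▷ (h ≫ g) ≫ f' ◁ h ◁ θ
  naturality _ _ β := mor_nat η θ β

/-- The unit constraint of `Mor`, with components `𝟙 ≫ h ≫ 𝟙 ≅ h`. -/
@[simps!]
def morMapId (a b : B) : morMap (𝟙 a) (𝟙 b) ≅ 𝟭 (a ⟶ b) :=
  NatIso.ofComponents (fun h => λ_ (h ≫ 𝟙 b) ≪≫ ρ_ h) (fun β => mor_id_nat β)

/-- The composition constraint of `Mor`, with components
`(f' ≫ f) ≫ h ≫ (g ≫ g') ≅ f' ≫ (f ≫ h ≫ g) ≫ g'`. -/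
@[simps!]
def morMapComp {a a' a'' b b' b'' : B} (f : a' ⟶ a) (g : b ⟶ b') (f' : a'' ⟶ a') (g' : b' ⟶ b'') :
    morMap (f' ≫ f) (g ≫ g') ≅ morMap f g ⋙ morMap f' g' :=
  NatIso.ofComponents
    (fun h => α_ f' f (h ≫ g ≫ g') ≪≫
      whiskerLeftIso f' (whiskerLeftIso f (α_ h g g').symm ≪≫ (α_ f (h ≫ g) g').symm))
    (fun β => mor_comp_nat f g f' g' β)

variable (B)

/-- The pseudofunctor `Mor : Bᵒᵖ × B ⥤ᵖ Cat` which sends `(a, b)` to the category of 1-cells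
`a ⟶ b`, sends a pair `(f, g)` to `h ↦ f ≫ h ≫ g`, and sends a pair of 2-cells to the
natural transformation given by horizontal composition with them. -/
def mor : (Bᵒᵖ × B) ⥤ᵖ Cat.{w, v} where
  obj p := Cat.of (p.1.unop ⟶ p.2)
  map f := (morMap f.1.unop f.2).toCatHom
  map₂ η := NatTrans.toCatHom₂ (morMap₂ η.1.unop2 η.2)
  map₂_id f := by
    ext h
    exact mor_map₂_id f.1.unop f.2 h
  map₂_comp η θ := by
    ext h
    exact mor_map₂_comp η.1.unop2 θ.1.unop2 η.2 θ.2 h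
  mapId p := Cat.Hom.isoMk (morMapId p.1.unop p.2)
  mapComp f g := Cat.Hom.isoMk (morMapComp f.1.unop f.2 g.1.unop g.2)
  map₂_whisker_left f g h η := by
    ext k
    exact mor_whisker_left f.1.unop f.2 η.1.unop2 η.2 k
  map₂_whisker_right η h := by
    ext k
    exact mor_whisker_right η.1.unop2 η.2 h.1.unop h.2 k
  map₂_associator f g h := by
    ext k
    exact mor_assoc f.1.unop g.1.unop h.1.unop f.2 g.2 h.2 k
  map₂_left_unitor f := by
    ext k
    exact mor_left_unitor f.1.unop f.2 k
  map₂_right_unitor f := by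
    ext k
    exact mor_right_unitor f.1.unop f.2 k

end Mor

section Biadjunction

variable {X : Type u₁} [Bicategory.{w, v} X] {A : Type u₂} [Bicategory.{w, v} A]

/-- The pseudofunctor `Mor_A(F -, -) : Xᵒᵖ × A ⥤ᵖ Cat`, i.e. `Mor_A ∘ (Fᵒᵖ × 1_A)`. -/
def morLeft (F : X ⥤ᵖ A) : (Xᵒᵖ × A) ⥤ᵖ Cat.{w, v} :=
  (prodPseudofunctor (opPseudofunctor F) (Pseudofunctor.id A)).comp (mor A)

/-- The pseudofunctor `Mor_X(-, G -) : Xᵒᵖ × A ⥤ᵖ Cat`, i.e. `Mor_X ∘ (1_{Xᵒᵖ} × G)`. -/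
def morRight (G : A ⥤ᵖ X) : (Xᵒᵖ × A) ⥤ᵖ Cat.{w, v} :=
  (prodPseudofunctor (Pseudofunctor.id Xᵒᵖ) G).comp (mor X)

/-- A biadjunction between `F : X ⥤ᵖ A` (on the left) and `G : A ⥤ᵖ X` (on the right): a pseudo
natural transformation `Mor_A(F -, -) ⇒ Mor_X(-, G -)` of pseudofunctors `Xᵒᵖ × A ⥤ᵖ Cat`
all of whose components `Mor_A(F x, a) ⥤ Mor_X(x, G a)` are equivalences of categories. -/
structure Biadjunction (F : X ⥤ᵖ A) (G : A ⥤ᵖ X) where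
  /-- The pseudo natural transformation. -/
  φ : Pseudofunctor.StrongTrans (morLeft F) (morRight G)
  /-- Its components are equivalences of categories. -/
  isEquivalence (x : X) (a : A) : (φ.app (op x, a)).toFunctor.IsEquivalence

/-- `F` is a left biadjoint for `G`. -/
def IsLeftBiadjoint (F : X ⥤ᵖ A) (G : A ⥤ᵖ X) : Prop :=
  Nonempty (Biadjunction F G)

end Biadjunction

section Biuniversal

variable {C : Type u₁} [Bicategory.{w₁, v₁} C] {D : Type u₂} [Bicategory.{w₂, v₂} D]

/-- For `u : c ⟶ S r`, the functor `Mor_D(r, d) ⥤ Mor_C(c, S d)` sending a 1-cell `f` to the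
composite of `u` followed by `S f`, and a 2-cell `γ` to the whiskering of `S γ` with `u`. -/
def arrowFunctor (S : D ⥤ᵖ C) {c : C} {r : D} (u : c ⟶ S.obj r) (d : D) :
    (r ⟶ d) ⥤ (c ⟶ S.obj d) where
  obj f := u ≫ S.map f
  map γ := u ◁ S.map₂ γ

/-- `u : c ⟶ S r` is a biuniversal arrow from `c` to `S`. -/
def IsBiuniversalArrow (S : D ⥤ᵖ C) {c : C} {r : D} (u : c ⟶ S.obj r) : Prop :=
  ∀ d : D, (arrowFunctor S u d).IsEquivalence

end Biuniversal

end Biadj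

/-!
A pseudo natural transformation `φ : Mor_A(F -, -) ⇒ Mor_X(-, G -)` is determined, up to
isomorphism, by its values at identities: this is the bicategorical Yoneda argument. Its unit
`η_x = φ (𝟙 (F x))` satisfies
`φ h ≅ φ (𝟙 ≫ h) ≅ η_x ≫ G h`, so the functor `h ↦ η_x ≫ G h` attached to `η_x` is isomorphic to
the component of `φ` at `(x, a)`, and one is an equivalence if and only if the other is. Conversely
a pseudo natural transformation `η : 1 ⇒ G F` gives the components `h ↦ η_x ≫ G h`. The content of
the proof is that the coherence laws of `φ` and of `η` imply each other.

Both implications go through `OneSidedTransformation`: functors `Φ x a` with constraints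
`Φ (F f ≫ h) ≅ f ≫ Φ h` and `Φ (h ≫ g) ≅ Φ h ≫ G g` which are coherent one by one and commute with
each other. `Transformation.toOneSided` extracts such data from `φ` by restricting its constraint
`Φ (F f ≫ h ≫ g) ≅ f ≫ Φ h ≫ G g` to `g = 𝟙` and to `f = 𝟙`; the two one-sided constraints commute
because both of their composites equal the two-sided one (`Transformation.left_right_eq_cell`,
`Transformation.right_left_eq_cell`). In the other direction
`OneSidedTransformation.toStrongTrans` composes the two constraints.

The constraint of the unit at `f` is the composite
`f ≫ Φ 𝟙 ≅ Φ (F f ≫ 𝟙) ≅ Φ (𝟙 ≫ F f) ≅ Φ 𝟙 ≫ G (F f)` (`OneSidedTransformation.unit`), and for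
given `η` the contravariant constraint of `h ↦ η_x ≫ G h` is the inverse of the constraint of `η`,
while the covariant one is that of `G` (`OneSidedTransformation.ofUnit`).
-/

namespace Biadj

open CategoryTheory Bicategory Opposite Bicategory.Opposite

/-! ### Pseudo natural transformations `Mor_A(F -, -) ⇒ Mor_X(-, G -)` in components -/

section Components

variable {X : Type u₁} [Bicategory.{w, v} X] {A : Type u₂} [Bicategory.{w, v} A]
  {F : X ⥤ᵖ A} {G : A ⥤ᵖ X}

namespace Transformation

variable (φ : Pseudofunctor.StrongTrans (morLeft F) (morRight G))

/-- The component `Mor_A(F x, a) ⥤ Mor_X(x, G a)` of a pseudo natural transformation. -/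
def component (x : X) (a : A) : (F.obj x ⟶ a) ⥤ (x ⟶ G.obj a) :=
  (φ.app (op x, a)).toFunctor

/-- The naturality constraint of `φ` at the pair `(f, g)`, evaluated at `h`. -/
def cell {x' x : X} {a a' : A} (f : x' ⟶ x) (h : F.obj x ⟶ a) (g : a ⟶ a') :
    (component φ x' a').obj (F.map f ≫ h ≫ g) ≅ f ≫ (component φ x a).obj h ≫ G.map g :=
  (Cat.Hom.toNatIso (φ.naturality (a := (op x, a)) (b := (op x', a')) (f.op, g))).app h

/-- Naturality of the constraint in its argument `h`. -/
theorem cell_naturality_middle {x' x : X} {a a' : A} (f : x' ⟶ x) {h k : F.obj x ⟶ a} (β : h ⟶ k)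
    (g : a ⟶ a') :
    (component φ x' a').map (F.map f ◁ β ▷ g) ≫ (cell φ f k g).hom =
      (cell φ f h g).hom ≫ f ◁ (component φ x a).map β ▷ G.map g :=
  (φ.naturality (a := (op x, a)) (b := (op x', a')) (f.op, g)).hom.toNatTrans.naturality β

/-- Naturality of the constraint in the pair `(f, g)`, with respect to 2-cells. -/
theorem cell_naturality {x' x : X} {a a' : A} {f f' : x' ⟶ x} (η : f ⟶ f') (h : F.obj x ⟶ a)
    {g g' : a ⟶ a'} (θ : g ⟶ g') :
    (component φ x' a').map (F.map₂ η ▷ (h ≫ g) ≫ F.map f' ◁ h ◁ θ) ≫ (cell φ f' h g').hom =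
      (cell φ f h g).hom ≫ η ▷ ((component φ x a).obj h ≫ G.map g) ≫
        f' ◁ (component φ x a).obj h ◁ G.map₂ θ :=
  congrArg (fun t => t.toNatTrans.app h) (φ.naturality_naturality (a := (op x, a))
    (b := (op x', a')) (f := (f.op, g)) (g := (f'.op, g')) (op2 η, θ))

/-- The unit law of `φ` evaluated at `h`. The right-hand side comes from the unit constraint of
`Mor_A(F -, -)`. -/
theorem cell_id {x : X} {a : A} (h : F.obj x ⟶ a) :
    (cell φ (𝟙 x) h (𝟙 a)).hom ≫ 𝟙 x ◁ (component φ x a).obj h ◁ (G.mapId a).hom ≫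
        (λ_ _).hom ≫ (ρ_ _).hom =
      (component φ x a).map ((F.mapId x).hom ▷ (h ≫ 𝟙 a) ≫ (λ_ _).hom ≫ (ρ_ _).hom) := by
  have := congrArg (fun t => t.toNatTrans.app h) (φ.naturality_id (op x, a))
  -- The identities are the 2-cells coming from `𝟙_{Xᵒᵖ}`, `𝟙_A` and the unitors of `Cat`.
  change (cell φ (𝟙 x) h (𝟙 a)).hom ≫
    ((𝟙 (𝟙 x) ▷ _ ≫ 𝟙 x ◁ (component φ x a).obj h ◁ (G.mapId a).hom) ≫
        (λ_ _).hom ≫ (ρ_ _).hom) =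
      (component φ x a).map (((F.mapId x).hom ▷ (h ≫ 𝟙 a) ≫ 𝟙 _ ◁ h ◁ 𝟙 (𝟙 a))
        ≫ (λ_ _).hom ≫ (ρ_ _).hom) ≫ 𝟙 _ ≫ 𝟙 _ at this
  simpa using this

/-- The composition law of `φ` evaluated at `h`. Composition in `Xᵒᵖ × A` reverses the order of
`f'` and `f`. -/
theorem cell_comp {x'' x' x : X} {a a' a'' : A} (f' : x'' ⟶ x') (f : x' ⟶ x) (h : F.obj x ⟶ a)
    (g : a ⟶ a') (g' : a' ⟶ a'') :
    (cell φ (f' ≫ f) h (g ≫ g')).hom ≫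
        (f' ≫ f) ◁ (component φ x a).obj h ◁ (G.mapComp g g').hom ≫
          (α_ _ _ _).hom ≫ f' ◁ (f ◁ (α_ _ _ _).inv ≫ (α_ _ _ _).inv) =
      (component φ x'' a'').map ((F.mapComp f' f).hom ▷ (h ≫ g ≫ g') ≫
          (α_ _ _ _).hom ≫ F.map f' ◁ (F.map f ◁ (α_ _ _ _).inv ≫ (α_ _ _ _).inv)) ≫
        (cell φ f' (F.map f ≫ h ≫ g) g').hom ≫ f' ◁ (cell φ f h g).hom ▷ G.map g' := by
  have := congrArg (fun t => t.toNatTrans.app h) (φ.naturality_comp (a := (op x, a))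
    (b := (op x', a')) (c := (op x'', a'')) (f.op, g) (f'.op, g'))
  -- The identities are the 2-cells coming from `𝟙_{Xᵒᵖ}`, `𝟙_A` and the associators of `Cat`.
  change (cell φ (f' ≫ f) h (g ≫ g')).hom ≫
      ((𝟙 (f' ≫ f) ▷ _ ≫ (f' ≫ f) ◁ (component φ x a).obj h ◁ (G.mapComp g g').hom) ≫
          (α_ _ _ _).hom ≫ f' ◁ (f ◁ (α_ _ _ _).inv ≫ (α_ _ _ _).inv)) =
      (component φ x'' a'').map (((F.mapComp f' f).hom ▷ (h ≫ g ≫ g') ≫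
          _ ◁ h ◁ 𝟙 (g ≫ g')) ≫
          (α_ _ _ _).hom ≫ F.map f' ◁ (F.map f ◁ (α_ _ _ _).inv ≫ (α_ _ _ _).inv)) ≫
        𝟙 _ ≫ (cell φ f' (F.map f ≫ h ≫ g) g').hom ≫ 𝟙 _ ≫
        f' ◁ (cell φ f h g).hom ▷ G.map g' ≫ 𝟙 _ at this
  simp only [id_whiskerRight, whiskerLeft_id, Category.id_comp, Category.comp_id] at this ⊢
  exact this

/-- The pseudo natural transformation `Mor_A(F -, -) ⇒ Mor_X(-, G -)` with components `Φ` and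
constraints `N`. The hypotheses are the axioms of a pseudo natural transformation evaluated at
1-cells, in the form in which `cell` satisfies them. -/
def ofCells (Φ : ∀ (x : X) (a : A), (F.obj x ⟶ a) ⥤ (x ⟶ G.obj a))
    (N : ∀ {x' x : X} {a a' : A} (f : x' ⟶ x) (h : F.obj x ⟶ a) (g : a ⟶ a'),
      (Φ x' a').obj (F.map f ≫ h ≫ g) ≅ f ≫ (Φ x a).obj h ≫ G.map g)
    (naturality_middle : ∀ {x' x : X} {a a' : A} (f : x' ⟶ x) {h k : F.obj x ⟶ a} (β : h ⟶ k)
      (g : a ⟶ a'), (Φ x' a').map (F.map f ◁ β ▷ g) ≫ (N f k g).hom =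
        (N f h g).hom ≫ f ◁ (Φ x a).map β ▷ G.map g)
    (naturality : ∀ {x' x : X} {a a' : A} {f f' : x' ⟶ x} (η : f ⟶ f') (h : F.obj x ⟶ a)
      {g g' : a ⟶ a'} (θ : g ⟶ g'),
      (Φ x' a').map (F.map₂ η ▷ (h ≫ g) ≫ F.map f' ◁ h ◁ θ) ≫ (N f' h g').hom =
        (N f h g).hom ≫ η ▷ ((Φ x a).obj h ≫ G.map g) ≫ f' ◁ (Φ x a).obj h ◁ G.map₂ θ)
    (id : ∀ {x : X} {a : A} (h : F.obj x ⟶ a),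
      (N (𝟙 x) h (𝟙 a)).hom ≫ 𝟙 x ◁ (Φ x a).obj h ◁ (G.mapId a).hom ≫ (λ_ _).hom ≫ (ρ_ _).hom =
        (Φ x a).map ((F.mapId x).hom ▷ (h ≫ 𝟙 a) ≫ (λ_ _).hom ≫ (ρ_ _).hom))
    (comp : ∀ {x'' x' x : X} {a a' a'' : A} (f' : x'' ⟶ x') (f : x' ⟶ x) (h : F.obj x ⟶ a)
      (g : a ⟶ a') (g' : a' ⟶ a''),
      (N (f' ≫ f) h (g ≫ g')).hom ≫ (f' ≫ f) ◁ (Φ x a).obj h ◁ (G.mapComp g g').hom ≫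
          (α_ _ _ _).hom ≫ f' ◁ (f ◁ (α_ _ _ _).inv ≫ (α_ _ _ _).inv) =
        (Φ x'' a'').map ((F.mapComp f' f).hom ▷ (h ≫ g ≫ g') ≫
            (α_ _ _ _).hom ≫ F.map f' ◁ (F.map f ◁ (α_ _ _ _).inv ≫ (α_ _ _ _).inv)) ≫
          (N f' (F.map f ≫ h ≫ g) g').hom ≫ f' ◁ (N f h g).hom ▷ G.map g') :
    Pseudofunctor.StrongTrans (morLeft F) (morRight G) where
  app p := (Φ p.1.unop p.2).toCatHom
  naturality {p q} f := Cat.Hom.isoMk (F := morMap (F.map f.1.unop) f.2 ⋙ Φ q.1.unop q.2)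
    (G := Φ p.1.unop p.2 ⋙ morMap f.1.unop (G.map f.2))
    (NatIso.ofComponents (fun h => N f.1.unop h f.2) (fun β => naturality_middle f.1.unop β f.2))
  naturality_naturality {p q f f'} η := by
    ext h
    exact naturality η.1.unop2 h η.2
  naturality_id p := by
    have evaluated {x : X} {a : A} (h : F.obj x ⟶ a) :
        (N (𝟙 x) h (𝟙 a)).hom ≫
          ((𝟙 (𝟙 x) ▷ _ ≫ 𝟙 x ◁ (Φ x a).obj h ◁ (G.mapId a).hom) ≫ (λ_ _).hom ≫ (ρ_ _).hom) =
        (Φ x a).map (((F.mapId x).hom ▷ (h ≫ 𝟙 a) ≫ 𝟙 _ ◁ h ◁ 𝟙 (𝟙 a)) ≫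
          (λ_ _).hom ≫ (ρ_ _).hom) ≫ 𝟙 _ ≫ 𝟙 _ := by
      simpa using id h
    ext h
    exact evaluated h
  naturality_comp {p q r} f g := by
    have evaluated {x'' x' x : X} {a a' a'' : A} (f' : x'' ⟶ x') (f : x' ⟶ x) (h : F.obj x ⟶ a)
        (g : a ⟶ a') (g' : a' ⟶ a'') :
        (N (f' ≫ f) h (g ≫ g')).hom ≫
          ((𝟙 (f' ≫ f) ▷ _ ≫ (f' ≫ f) ◁ (Φ x a).obj h ◁ (G.mapComp g g').hom) ≫
            (α_ _ _ _).hom ≫ f' ◁ (f ◁ (α_ _ _ _).inv ≫ (α_ _ _ _).inv)) =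
        (Φ x'' a'').map (((F.mapComp f' f).hom ▷ (h ≫ g ≫ g') ≫ _ ◁ h ◁ 𝟙 (g ≫ g')) ≫
            (α_ _ _ _).hom ≫ F.map f' ◁ (F.map f ◁ (α_ _ _ _).inv ≫ (α_ _ _ _).inv)) ≫
          𝟙 _ ≫ (N f' (F.map f ≫ h ≫ g) g').hom ≫ 𝟙 _ ≫
          f' ◁ (N f h g).hom ▷ G.map g' ≫ 𝟙 _ := by
      have := comp f' f h g g'
      simp only [id_whiskerRight, whiskerLeft_id, Category.id_comp, Category.comp_id] at this ⊢
      exact this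
    ext h
    exact evaluated g.1.unop f.1.unop h f.2 g.2

end Transformation

end Components

/-! ### Transformations natural in each variable separately -/

section OneSided

variable {X : Type u₁} [Bicategory.{w, v} X] {A : Type u₂} [Bicategory.{w, v} A]

/-- A family of functors `Φ x a : Mor_A(F x, a) ⥤ Mor_X(x, G a)` which is pseudo natural in `x`, by
means of `left`, and in `a`, by means of `right`, in such a way that the two constraints commute
with each other. This is a pseudo natural transformation `Mor_A(F -, -) ⇒ Mor_X(-, G -)`
presented one variable at a time. -/
structure OneSidedTransformation (F : X ⥤ᵖ A) (G : A ⥤ᵖ X) where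
  /-- The component functors. -/
  Φ (x : X) (a : A) : (F.obj x ⟶ a) ⥤ (x ⟶ G.obj a)
  /-- The naturality constraint in the contravariant variable. -/
  left {x' x : X} {a : A} (f : x' ⟶ x) (h : F.obj x ⟶ a) :
    (Φ x' a).obj (F.map f ≫ h) ≅ f ≫ (Φ x a).obj h
  /-- The naturality constraint in the covariant variable. -/
  right {x : X} {a a' : A} (h : F.obj x ⟶ a) (g : a ⟶ a') :
    (Φ x a').obj (h ≫ g) ≅ (Φ x a).obj h ≫ G.map g
  left_naturality_left {x' x : X} {a : A} {f f' : x' ⟶ x} (η : f ⟶ f') (h : F.obj x ⟶ a) :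
    (Φ x' a).map (F.map₂ η ▷ h) ≫ (left f' h).hom = (left f h).hom ≫ η ▷ (Φ x a).obj h
  left_naturality_right {x' x : X} {a : A} (f : x' ⟶ x) {h k : F.obj x ⟶ a} (β : h ⟶ k) :
    (Φ x' a).map (F.map f ◁ β) ≫ (left f k).hom = (left f h).hom ≫ f ◁ (Φ x a).map β
  right_naturality_left {x : X} {a a' : A} {h k : F.obj x ⟶ a} (β : h ⟶ k) (g : a ⟶ a') :
    (Φ x a').map (β ▷ g) ≫ (right k g).hom = (right h g).hom ≫ (Φ x a).map β ▷ G.map g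
  right_naturality_right {x : X} {a a' : A} (h : F.obj x ⟶ a) {g g' : a ⟶ a'} (θ : g ⟶ g') :
    (Φ x a').map (h ◁ θ) ≫ (right h g').hom = (right h g).hom ≫ (Φ x a).obj h ◁ G.map₂ θ
  left_id {x : X} {a : A} (h : F.obj x ⟶ a) :
    (left (𝟙 x) h).hom ≫ (λ_ _).hom = (Φ x a).map ((F.mapId x).hom ▷ h ≫ (λ_ h).hom)
  right_id {x : X} {a : A} (h : F.obj x ⟶ a) :
    (right h (𝟙 a)).hom ≫ (Φ x a).obj h ◁ (G.mapId a).hom ≫ (ρ_ _).hom = (Φ x a).map (ρ_ h).hom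
  left_comp {x'' x' x : X} {a : A} (f' : x'' ⟶ x') (f : x' ⟶ x) (h : F.obj x ⟶ a) :
    (left (f' ≫ f) h).hom ≫ (α_ _ _ _).hom =
      (Φ x'' a).map ((F.mapComp f' f).hom ▷ h ≫ (α_ _ _ _).hom) ≫
        (left f' (F.map f ≫ h)).hom ≫ f' ◁ (left f h).hom
  right_comp {x : X} {a a' a'' : A} (h : F.obj x ⟶ a) (g : a ⟶ a') (g' : a' ⟶ a'') :
    (right h (g ≫ g')).hom ≫ (Φ x a).obj h ◁ (G.mapComp g g').hom ≫ (α_ _ _ _).inv =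
      (Φ x a'').map (α_ h g g').inv ≫ (right (h ≫ g) g').hom ≫ (right h g).hom ▷ G.map g'
  left_right {x' x : X} {a a' : A} (f : x' ⟶ x) (h : F.obj x ⟶ a) (g : a ⟶ a') :
    (Φ x' a').map (α_ (F.map f) h g).hom ≫ (left f (h ≫ g)).hom ≫ f ◁ (right h g).hom =
      (right (F.map f ≫ h) g).hom ≫ (left f h).hom ▷ G.map g ≫ (α_ _ _ _).hom

namespace OneSidedTransformation

variable {F : X ⥤ᵖ A} {G : A ⥤ᵖ X} (D : OneSidedTransformation F G)

/-- The two-variable constraint, composed of the constraints in each variable. -/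
def cell {x' x : X} {a a' : A} (f : x' ⟶ x) (h : F.obj x ⟶ a) (g : a ⟶ a') :
    (D.Φ x' a').obj (F.map f ≫ h ≫ g) ≅ f ≫ (D.Φ x a).obj h ≫ G.map g :=
  D.left f (h ≫ g) ≪≫ whiskerLeftIso f (D.right h g)

theorem cell_comp {x'' x' x : X} {a a' a'' : A} (f' : x'' ⟶ x') (f : x' ⟶ x) (h : F.obj x ⟶ a)
    (g : a ⟶ a') (g' : a' ⟶ a'') :
    (D.cell (f' ≫ f) h (g ≫ g')).hom ≫ (f' ≫ f) ◁ (D.Φ x a).obj h ◁ (G.mapComp g g').hom ≫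
          (α_ _ _ _).hom ≫ f' ◁ (f ◁ (α_ _ _ _).inv ≫ (α_ _ _ _).inv) =
        (D.Φ x'' a'').map ((F.mapComp f' f).hom ▷ (h ≫ g ≫ g') ≫
            (α_ _ _ _).hom ≫ F.map f' ◁ (F.map f ◁ (α_ _ _ _).inv ≫ (α_ _ _ _).inv)) ≫
          (D.cell f' (F.map f ≫ h ≫ g) g').hom ≫ f' ◁ (D.cell f h g).hom ▷ G.map g' := by
  -- The law `left_right`, solved for the side on which `left` comes first.
  have hl : (D.left f ((h ≫ g) ≫ g')).hom ≫ f ◁ (D.right (h ≫ g) g').hom ≫ (α_ _ _ _).inv =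
      (D.Φ x' a'').map (α_ (F.map f) (h ≫ g) g').inv ≫
        (D.right (F.map f ≫ h ≫ g) g').hom ≫ (D.left f (h ≫ g)).hom ▷ G.map g' := by
    rw [← cancel_epi ((D.Φ x' a'').map (α_ (F.map f) (h ≫ g) g').hom),
      reassoc_of% (D.left_right f (h ≫ g) g'), ← Functor.map_comp_assoc]
    simp
  calc _ = ((D.left (f' ≫ f) (h ≫ g ≫ g')).hom ≫ (α_ _ _ _).hom) ≫ f' ◁ f ◁
        ((D.right h (g ≫ g')).hom ≫ (D.Φ x a).obj h ◁ (G.mapComp g g').hom ≫ (α_ _ _ _).inv) ≫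
          f' ◁ (α_ _ _ _).inv := by
        simp [cell]
    _ = (D.Φ x'' a'').map ((F.mapComp f' f).hom ▷ (h ≫ g ≫ g') ≫ (α_ _ _ _).hom) ≫
        (D.left f' (F.map f ≫ h ≫ g ≫ g')).hom ≫
        f' ◁ ((D.left f (h ≫ g ≫ g')).hom ≫ f ◁ (D.Φ x a'').map (α_ h g g').inv ≫
          f ◁ (D.right (h ≫ g) g').hom ≫ (α_ _ _ _).inv ≫ (f ◁ (D.right h g).hom) ▷ G.map g') := by
        rw [D.left_comp, D.right_comp]
        simp
    _ = _ := by
        rw [← reassoc_of% D.left_naturality_right, reassoc_of% hl, whiskerLeft_comp,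
          ← reassoc_of% D.left_naturality_right, whiskerLeft_comp,
          ← reassoc_of% D.left_naturality_right]
        simp [cell]

theorem cell_id {x : X} {a : A} (h : F.obj x ⟶ a) :
    (D.cell (𝟙 x) h (𝟙 a)).hom ≫ 𝟙 x ◁ (D.Φ x a).obj h ◁ (G.mapId a).hom ≫
        (λ_ _).hom ≫ (ρ_ _).hom =
      (D.Φ x a).map ((F.mapId x).hom ▷ (h ≫ 𝟙 a) ≫ (λ_ _).hom ≫ (ρ_ _).hom) := by
  calc _ = ((D.left (𝟙 x) (h ≫ 𝟙 a)).hom ≫ (λ_ _).hom) ≫ (D.right h (𝟙 a)).hom ≫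
        (D.Φ x a).obj h ◁ (G.mapId a).hom ≫ (ρ_ _).hom := by
        simp [cell]
    _ = _ := by
        rw [D.left_id, D.right_id, ← Functor.map_comp, Category.assoc]

/-- The pseudo natural transformation presented by a one-sided transformation. -/
def toStrongTrans : Pseudofunctor.StrongTrans (morLeft F) (morRight G) :=
  Transformation.ofCells D.Φ D.cell
    (fun f h k β g => by
      simp only [cell, Iso.trans_hom, whiskerLeftIso_hom, Category.assoc,
        reassoc_of% D.left_naturality_right, ← whiskerLeft_comp, D.right_naturality_left])
    (fun η h g g' θ => by
      simp only [cell, Iso.trans_hom, whiskerLeftIso_hom, Category.assoc, Functor.map_comp,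
        reassoc_of% D.left_naturality_right, reassoc_of% D.left_naturality_left, ← whiskerLeft_comp,
        D.right_naturality_right, whisker_exchange_assoc])
    D.cell_id D.cell_comp

end OneSidedTransformation

end OneSided

/-! ### Splitting a constraint into its two one-sided parts -/

section TwoSided

variable {X : Type u₁} [Bicategory.{w, v} X] {A : Type u₂} [Bicategory.{w, v} A]

theorem map₂_rightUnitor_inv_mapComp (F : X ⥤ᵖ A) {x y : X} (f : x ⟶ y) :
    F.map₂ (ρ_ f).inv ≫ (F.mapComp f (𝟙 y)).hom =
      (ρ_ (F.map f)).inv ≫ F.map f ◁ (F.mapId y).inv := by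
  rw [F.mapComp_id_right_hom, ← F.map₂_comp_assoc]
  simp

theorem map₂_leftUnitor_inv_mapComp (F : X ⥤ᵖ A) {x y : X} (f : x ⟶ y) :
    F.map₂ (λ_ f).inv ≫ (F.mapComp (𝟙 x) f).hom =
      (λ_ (F.map f)).inv ≫ (F.mapId x).inv ▷ F.map f := by
  rw [F.mapComp_id_left_hom, ← F.map₂_comp_assoc]
  simp

/-- Whiskering with `G(𝟙 a)` on the right is isomorphic to the identity, naturally in 2-cells. -/
theorem whiskerRight_mapId_rightUnitor (G : A ⥤ᵖ X) {x : X} {a : A} {p q : x ⟶ G.obj a}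
    (β : p ⟶ q) :
    β ▷ G.map (𝟙 a) ≫ q ◁ (G.mapId a).hom ≫ (ρ_ q).hom =
      p ◁ (G.mapId a).hom ≫ (ρ_ p).hom ≫ β := by
  rw [← whisker_exchange_assoc, rightUnitor_naturality]

namespace Transformation

variable {F : X ⥤ᵖ A} {G : A ⥤ᵖ X} (φ : Pseudofunctor.StrongTrans (morLeft F) (morRight G))

theorem cell_naturality_left {x' x : X} {a a' : A} {f f' : x' ⟶ x} (η : f ⟶ f') (h : F.obj x ⟶ a)
    (g : a ⟶ a') :
    (component φ x' a').map (F.map₂ η ▷ (h ≫ g)) ≫ (cell φ f' h g).hom =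
      (cell φ f h g).hom ≫ η ▷ ((component φ x a).obj h ≫ G.map g) := by
  simpa using cell_naturality φ η h (𝟙 g)

theorem cell_naturality_right {x' x : X} {a a' : A} (f : x' ⟶ x) (h : F.obj x ⟶ a)
    {g g' : a ⟶ a'} (θ : g ⟶ g') :
    (component φ x' a').map (F.map f ◁ h ◁ θ) ≫ (cell φ f h g').hom =
      (cell φ f h g).hom ≫ f ◁ (component φ x a).obj h ◁ G.map₂ θ := by
  simpa using cell_naturality φ (𝟙 f) h θ

/-- `cell_comp` solved for the part that involves `G.mapComp`. -/
theorem cell_comp' {x'' x' x : X} {a a' a'' : A} (f' : x'' ⟶ x') (f : x' ⟶ x) (h : F.obj x ⟶ a)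
    (g : a ⟶ a') (g' : a' ⟶ a'') :
    (cell φ (f' ≫ f) h (g ≫ g')).hom ≫
        (f' ≫ f) ◁ (component φ x a).obj h ◁ (G.mapComp g g').hom =
      (component φ x'' a'').map ((F.mapComp f' f).hom ▷ (h ≫ g ≫ g') ≫
          (α_ _ _ _).hom ≫ F.map f' ◁ (F.map f ◁ (α_ _ _ _).inv ≫ (α_ _ _ _).inv)) ≫
        (cell φ f' (F.map f ≫ h ≫ g) g').hom ≫ f' ◁ (cell φ f h g).hom ▷ G.map g' ≫
        f' ◁ ((α_ _ _ _).hom ≫ f ◁ (α_ _ _ _).hom) ≫ (α_ _ _ _).inv := by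
  rw [← reassoc_of% (cell_comp φ f' f h g g')]
  simp

/-- The constraint of `φ` in the contravariant variable: its constraint at `(f, 𝟙)`, freed of the
identity 1-cell. -/
def left {x' x : X} {a : A} (f : x' ⟶ x) (h : F.obj x ⟶ a) :
    (component φ x' a).obj (F.map f ≫ h) ≅ f ≫ (component φ x a).obj h :=
  (component φ x' a).mapIso (whiskerLeftIso (F.map f) (ρ_ h).symm) ≪≫ cell φ f h (𝟙 a) ≪≫
    whiskerLeftIso f (whiskerLeftIso _ (G.mapId a) ≪≫ ρ_ _)

/-- The constraint of `φ` in the covariant variable: its constraint at `(𝟙, g)`, freed of the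
identity 1-cell. -/
def right {x : X} {a a' : A} (h : F.obj x ⟶ a) (g : a ⟶ a') :
    (component φ x a').obj (h ≫ g) ≅ (component φ x a).obj h ≫ G.map g :=
  (component φ x a').mapIso ((λ_ (h ≫ g)).symm ≪≫ whiskerRightIso (F.mapId x).symm (h ≫ g)) ≪≫
    cell φ (𝟙 x) h g ≪≫ λ_ _

theorem left_naturality_left {x' x : X} {a : A} {f f' : x' ⟶ x} (η : f ⟶ f') (h : F.obj x ⟶ a) :
    (component φ x' a).map (F.map₂ η ▷ h) ≫ (left φ f' h).hom =
      (left φ f h).hom ≫ η ▷ (component φ x a).obj h := by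
  simp only [left, Iso.trans_hom, Functor.mapIso_hom, whiskerLeftIso_hom, Iso.symm_hom,
    ← Functor.map_comp_assoc, ← whisker_exchange]
  simp only [Functor.map_comp, Category.assoc, reassoc_of% (cell_naturality_left φ),
    ← whisker_exchange]

theorem left_naturality_right {x' x : X} {a : A} (f : x' ⟶ x) {h k : F.obj x ⟶ a} (β : h ⟶ k) :
    (component φ x' a).map (F.map f ◁ β) ≫ (left φ f k).hom =
      (left φ f h).hom ≫ f ◁ (component φ x a).map β := by
  simp only [left, Iso.trans_hom, Functor.mapIso_hom, whiskerLeftIso_hom, Iso.symm_hom,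
    ← Functor.map_comp_assoc, ← whiskerLeft_comp, rightUnitor_inv_naturality]
  simp only [Functor.map_comp, Category.assoc, whiskerLeft_comp,
    reassoc_of% (cell_naturality_middle φ)]
  simp only [← whiskerLeft_comp, whiskerRight_mapId_rightUnitor]

theorem right_naturality_left {x : X} {a a' : A} {h k : F.obj x ⟶ a} (β : h ⟶ k) (g : a ⟶ a') :
    (component φ x a').map (β ▷ g) ≫ (right φ k g).hom =
      (right φ h g).hom ≫ (component φ x a).map β ▷ G.map g := by
  simp only [right, Iso.trans_hom, Functor.mapIso_hom, Iso.symm_hom, whiskerRightIso_hom,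
    ← Functor.map_comp_assoc, leftUnitor_inv_naturality_assoc, whisker_exchange]
  simp only [Functor.map_comp, Category.assoc, reassoc_of% (cell_naturality_middle φ),
    leftUnitor_naturality]

theorem right_naturality_right {x : X} {a a' : A} (h : F.obj x ⟶ a) {g g' : a ⟶ a'} (θ : g ⟶ g') :
    (component φ x a').map (h ◁ θ) ≫ (right φ h g').hom =
      (right φ h g).hom ≫ (component φ x a).obj h ◁ G.map₂ θ := by
  simp only [right, Iso.trans_hom, Functor.mapIso_hom, Iso.symm_hom, whiskerRightIso_hom,
    ← Functor.map_comp_assoc, leftUnitor_inv_naturality_assoc, whisker_exchange]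
  simp only [Functor.map_comp, Category.assoc, reassoc_of% (cell_naturality_right φ),
    leftUnitor_naturality]

theorem left_id {x : X} {a : A} (h : F.obj x ⟶ a) :
    (left φ (𝟙 x) h).hom ≫ (λ_ _).hom =
      (component φ x a).map ((F.mapId x).hom ▷ h ≫ (λ_ h).hom) := by
  have := cell_id φ h
  simp only [left, Iso.trans_hom, Functor.mapIso_hom, whiskerLeftIso_hom, Iso.symm_hom,
    Category.assoc, whiskerLeft_comp, leftUnitor_naturality]
  rw [this, ← Functor.map_comp, whisker_exchange_assoc]
  congr 1
  bicategory

theorem right_id {x : X} {a : A} (h : F.obj x ⟶ a) :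
    (right φ h (𝟙 a)).hom ≫ (component φ x a).obj h ◁ (G.mapId a).hom ≫ (ρ_ _).hom =
      (component φ x a).map (ρ_ h).hom := by
  have := cell_id φ h
  simp only [right, Iso.trans_hom, Functor.mapIso_hom, Iso.symm_hom, Category.assoc,
    ← leftUnitor_naturality_assoc]
  rw [this, ← Functor.map_comp]
  simp

/-- The constraint at `(f' ≫ f, 𝟙)` is compared with the one at `(f' ≫ f, 𝟙 ≫ 𝟙)`, to which the
composition law of `φ` applies. -/
theorem left_comp {x'' x' x : X} {a : A} (f' : x'' ⟶ x') (f : x' ⟶ x) (h : F.obj x ⟶ a) :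
    (left φ (f' ≫ f) h).hom ≫ (α_ _ _ _).hom =
      (component φ x'' a).map ((F.mapComp f' f).hom ▷ h ≫ (α_ _ _ _).hom) ≫
        (left φ f' (F.map f ≫ h)).hom ≫ f' ◁ (left φ f h).hom := by
  have hG : (cell φ (f' ≫ f) h (𝟙 a)).hom =
      (component φ x'' a).map (F.map (f' ≫ f) ◁ h ◁ (ρ_ (𝟙 a)).inv) ≫
        (cell φ (f' ≫ f) h (𝟙 a ≫ 𝟙 a)).hom ≫
        (f' ≫ f) ◁ (component φ x a).obj h ◁ (G.mapComp (𝟙 a) (𝟙 a)).hom ≫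
        (f' ≫ f) ◁ (component φ x a).obj h ◁ (G.map (𝟙 a) ◁ (G.mapId a).hom ≫ (ρ_ _).hom) := by
    simp only [← whiskerLeft_comp]
    rw [← G.map₂_right_unitor, ← cell_naturality_right, ← Functor.map_comp_assoc]
    simp
  calc _ = (component φ x'' a).map (F.map (f' ≫ f) ◁ (ρ_ h).inv ≫
          F.map (f' ≫ f) ◁ h ◁ (ρ_ (𝟙 a)).inv ≫ (F.mapComp f' f).hom ▷ (h ≫ 𝟙 a ≫ 𝟙 a) ≫
          (α_ _ _ _).hom ≫ F.map f' ◁ (F.map f ◁ (α_ _ _ _).inv ≫ (α_ _ _ _).inv)) ≫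
        (cell φ f' (F.map f ≫ h ≫ 𝟙 a) (𝟙 a)).hom ≫
        f' ◁ ((cell φ f h (𝟙 a)).hom ▷ G.map (𝟙 a) ≫ _ ◁ (G.mapId a).hom ≫ (ρ_ _).hom) ≫
        f' ◁ f ◁ ((component φ x a).obj h ◁ (G.mapId a).hom ≫ (ρ_ _).hom) := by
        simp only [left, Iso.trans_hom, Functor.mapIso_hom, whiskerLeftIso_hom, Iso.symm_hom]
        rw [hG]
        simp only [Category.assoc]
        rw [reassoc_of% (cell_comp' φ)]
        simp only [← Functor.map_comp_assoc]
        bicategory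
    _ = _ := by
        rw [whiskerRight_mapId_rightUnitor]
        simp only [left, Iso.trans_hom, Functor.mapIso_hom, whiskerLeftIso_hom, Iso.symm_hom,
          whiskerLeft_comp, Category.assoc]
        -- The 2-cell of `A` is moved across `G (𝟙 a)` so that naturality of `cell` absorbs it.
        have slide := congrArg (f' ◁ ·) (whiskerRight_mapId_rightUnitor G
          ((component φ x' a).map (F.map f ◁ (ρ_ h).inv)))
        simp only [whiskerLeft_comp] at slide
        rw [← reassoc_of% slide, ← reassoc_of% (cell_naturality_middle φ)]
        simp only [← Functor.map_comp_assoc]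
        congr 2
        have : F.map (f' ≫ f) ◁ (ρ_ h).inv ≫
          F.map (f' ≫ f) ◁ h ◁ (ρ_ (𝟙 a)).inv ≫ (F.mapComp f' f).hom ▷ (h ≫ 𝟙 a ≫ 𝟙 a) =
            (F.mapComp f' f).hom ▷ h ≫ (_ ◁ (ρ_ h).inv ≫ _ ◁ h ◁ (ρ_ (𝟙 a)).inv) := by
          simp only [whisker_exchange_assoc, whisker_exchange]
        rw [reassoc_of% this]
        bicategory

/-- The constraint at `(𝟙, g ≫ g')` is compared with the one at `(𝟙 ≫ 𝟙, g ≫ g')`, to which the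
composition law of `φ` applies. -/
theorem right_comp {x : X} {a a' a'' : A} (h : F.obj x ⟶ a) (g : a ⟶ a') (g' : a' ⟶ a'') :
    (right φ h (g ≫ g')).hom ≫ (component φ x a).obj h ◁ (G.mapComp g g').hom ≫ (α_ _ _ _).inv =
      (component φ x a'').map (α_ h g g').inv ≫
        (right φ (h ≫ g) g').hom ≫ (right φ h g).hom ▷ G.map g' := by
  have hF : (cell φ (𝟙 x) h (g ≫ g')).hom =
      (component φ x a'').map (F.map₂ (ρ_ (𝟙 x)).inv ▷ (h ≫ g ≫ g')) ≫
        (cell φ (𝟙 x ≫ 𝟙 x) h (g ≫ g')).hom ≫ (ρ_ (𝟙 x)).hom ▷ _ := by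
    rw [← cell_naturality_left, ← Functor.map_comp_assoc, ← comp_whiskerRight, ← F.map₂_comp]
    simp
  calc _ = (component φ x a'').map ((λ_ (h ≫ g ≫ g')).inv ≫ (F.mapId x).inv ▷ (h ≫ g ≫ g') ≫
          (F.map₂ (ρ_ (𝟙 x)).inv ≫ (F.mapComp (𝟙 x) (𝟙 x)).hom) ▷ (h ≫ g ≫ g') ≫
          (α_ _ _ _).hom ≫ F.map (𝟙 x) ◁ (F.map (𝟙 x) ◁ (α_ _ _ _).inv ≫ (α_ _ _ _).inv)) ≫
        (cell φ (𝟙 x) (F.map (𝟙 x) ≫ h ≫ g) g').hom ≫ 𝟙 x ◁ (cell φ (𝟙 x) h g).hom ▷ G.map g' ≫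
        (λ_ _).hom ≫ (λ_ _).hom ▷ _ := by
        simp only [right, Iso.trans_hom, Functor.mapIso_hom, whiskerRightIso_hom, Iso.symm_hom,
          Category.assoc, ← leftUnitor_naturality_assoc]
        rw [hF, Category.assoc, Category.assoc, ← whisker_exchange_assoc,
          reassoc_of% (cell_comp' φ)]
        simp only [← Functor.map_comp_assoc, Category.assoc, comp_whiskerRight]
        bicategory
    _ = _ := by
        rw [map₂_rightUnitor_inv_mapComp]
        simp only [right, Iso.trans_hom, Functor.mapIso_hom, whiskerRightIso_hom, Iso.symm_hom,
          comp_whiskerRight, Category.assoc]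
        rw [← leftUnitor_naturality_assoc, ← reassoc_of% (cell_naturality_middle φ),
          leftUnitor_naturality_assoc]
        simp only [← Functor.map_comp_assoc]
        congr 2
        bicategory

/-- This is the composition law of `φ` for the factorization of `(f, g)` through `(𝟙, g)` followed by
`(f, 𝟙)`. -/
theorem left_right_eq_cell {x' x : X} {a a' : A} (f : x' ⟶ x) (h : F.obj x ⟶ a) (g : a ⟶ a') :
    (left φ f (h ≫ g)).hom ≫ f ◁ (right φ h g).hom = (cell φ f h g).hom := by
  -- `(f, g)` is replaced by an isomorphic pair that is a composite.
  have hc : (cell φ f h g).hom =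
      (component φ x' a').map (F.map₂ (ρ_ f).inv ▷ (h ≫ g) ≫ F.map (f ≫ 𝟙 x) ◁ h ◁ (ρ_ g).inv) ≫
        (cell φ (f ≫ 𝟙 x) h (g ≫ 𝟙 a')).hom ≫
        (f ≫ 𝟙 x) ◁ (component φ x a).obj h ◁ (G.mapComp g (𝟙 a')).hom ≫
        (f ≫ 𝟙 x) ◁ (component φ x a).obj h ◁ (G.map g ◁ (G.mapId a').hom ≫ (ρ_ _).hom) ≫
        (ρ_ f).hom ▷ _ := by
    rw [← whiskerLeft_comp_assoc, ← whiskerLeft_comp, ← G.map₂_right_unitor,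
      ← reassoc_of% (cell_naturality_right φ), ← cell_naturality_left]
    simp only [← Functor.map_comp_assoc, Category.assoc, whiskerLeft_whiskerLeft_inv_hom_assoc,
      ← comp_whiskerRight, ← F.map₂_comp, Iso.inv_hom_id, F.map₂_id, id_whiskerRight]
    rw [CategoryTheory.Functor.map_id, Category.id_comp]
  have hF := map₂_rightUnitor_inv_mapComp F f
  symm
  calc _ = (component φ x' a').map (F.map f ◁ h ◁ (ρ_ g).inv ≫
            (F.map₂ (ρ_ f).inv ≫ (F.mapComp f (𝟙 x)).hom) ▷ (h ≫ g ≫ 𝟙 a') ≫ (α_ _ _ _).hom ≫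
            F.map f ◁ (F.map (𝟙 x) ◁ (α_ _ _ _).inv ≫ (α_ _ _ _).inv)) ≫
          (cell φ f (F.map (𝟙 x) ≫ h ≫ g) (𝟙 a')).hom ≫
          f ◁ ((cell φ (𝟙 x) h g).hom ▷ G.map (𝟙 a') ≫ _ ◁ (G.mapId a').hom ≫ (ρ_ _).hom) ≫
          f ◁ (λ_ _).hom := by
        rw [hc, reassoc_of% (cell_comp' φ), comp_whiskerRight_assoc, whisker_exchange_assoc]
        simp only [← Functor.map_comp_assoc, Category.assoc]
        rw [whisker_exchange_assoc]
        bicategory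
    _ = _ := by
        -- The 2-cell of `A` is moved across `G (𝟙 a')` so that naturality of `cell` absorbs it.
        have slide := congrArg (f ◁ ·) (whiskerRight_mapId_rightUnitor G
          ((component φ x a').map ((λ_ (h ≫ g)).inv ≫ (F.mapId x).inv ▷ (h ≫ g))))
        simp only [whiskerLeft_comp] at slide
        rw [hF, whiskerRight_mapId_rightUnitor]
        simp only [left, right, Iso.trans_hom, Functor.mapIso_hom, whiskerLeftIso_hom,
          Iso.symm_hom, whiskerRightIso_hom, whiskerLeft_comp, Category.assoc]
        rw [← reassoc_of% slide, ← reassoc_of% (cell_naturality_middle φ)]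
        simp only [← Functor.map_comp_assoc]
        congr 2
        bicategory

/-- This is the composition law of `φ` for the factorization of `(f, g)` through `(f, 𝟙)` followed by
`(𝟙, g)`. -/
theorem right_left_eq_cell {x' x : X} {a a' : A} (f : x' ⟶ x) (h : F.obj x ⟶ a) (g : a ⟶ a') :
    (right φ (F.map f ≫ h) g).hom ≫ (left φ f h).hom ▷ G.map g ≫ (α_ _ _ _).hom =
      (component φ x' a').map (α_ (F.map f) h g).hom ≫ (cell φ f h g).hom := by
  -- `(f, g)` is replaced by an isomorphic pair that is a composite.
  have hc : (cell φ f h g).hom =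
      (component φ x' a').map (F.map₂ (λ_ f).inv ▷ (h ≫ g) ≫ F.map (𝟙 x' ≫ f) ◁ h ◁ (λ_ g).inv) ≫
        (cell φ (𝟙 x' ≫ f) h (𝟙 a ≫ g)).hom ≫
        (𝟙 x' ≫ f) ◁ (component φ x a).obj h ◁ (G.mapComp (𝟙 a) g).hom ≫
        (𝟙 x' ≫ f) ◁ (component φ x a).obj h ◁ ((G.mapId a).hom ▷ G.map g ≫ (λ_ _).hom) ≫
        (λ_ f).hom ▷ _ := by
    rw [← whiskerLeft_comp_assoc, ← whiskerLeft_comp, ← G.map₂_left_unitor,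
      ← reassoc_of% (cell_naturality_right φ), ← cell_naturality_left]
    simp only [← Functor.map_comp_assoc, Category.assoc, whiskerLeft_whiskerLeft_inv_hom_assoc,
      ← comp_whiskerRight, ← F.map₂_comp, Iso.inv_hom_id, F.map₂_id, id_whiskerRight]
    rw [CategoryTheory.Functor.map_id, Category.id_comp]
  have hF := map₂_leftUnitor_inv_mapComp F f
  symm
  calc _ = (component φ x' a').map ((α_ _ _ _).hom ≫
            (F.map₂ (λ_ f).inv ≫ (F.mapComp (𝟙 x') f).hom) ▷ (h ≫ g) ≫
            (F.map (𝟙 x') ≫ F.map f) ◁ h ◁ (λ_ g).inv ≫ (α_ _ _ _).hom ≫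
            F.map (𝟙 x') ◁ (F.map f ◁ (α_ _ _ _).inv ≫ (α_ _ _ _).inv)) ≫
          (cell φ (𝟙 x') (F.map f ≫ h ≫ 𝟙 a) g).hom ≫
          𝟙 x' ◁ ((cell φ f h (𝟙 a)).hom ≫ f ◁ (_ ◁ (G.mapId a).hom ≫ (ρ_ _).hom)) ▷ G.map g ≫
          (λ_ _).hom ≫ (α_ _ _ _).hom := by
        rw [hc, reassoc_of% (cell_comp' φ), comp_whiskerRight_assoc]
        simp only [← Functor.map_comp_assoc, Category.assoc]
        rw [whisker_exchange_assoc]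
        bicategory
    _ = _ := by
        rw [hF]
        simp only [left, right, Iso.trans_hom, Functor.mapIso_hom, whiskerLeftIso_hom,
          Iso.symm_hom, whiskerRightIso_hom, comp_whiskerRight, Category.assoc,
          ← leftUnitor_naturality_assoc, whiskerLeft_comp]
        rw [← reassoc_of% (cell_naturality_middle φ)]
        simp only [← Functor.map_comp_assoc]
        congr 2
        bicategory

/-- The one-sided transformation underlying a pseudo natural transformation in two variables. -/
def toOneSided : OneSidedTransformation F G where
  Φ := component φ
  left := left φ
  right := right φ
  left_naturality_left := left_naturality_left φ
  left_naturality_right := left_naturality_right φ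
  right_naturality_left := right_naturality_left φ
  right_naturality_right := right_naturality_right φ
  left_id := left_id φ
  right_id := right_id φ
  left_comp := left_comp φ
  right_comp := right_comp φ
  left_right f h g := by
    rw [left_right_eq_cell, right_left_eq_cell]

end Transformation

end TwoSided

/-! ### The unit of a one-sided transformation -/

section Unit

variable {X : Type u₁} [Bicategory.{w, v} X] {A : Type u₂} [Bicategory.{w, v} A]
  {F : X ⥤ᵖ A} {G : A ⥤ᵖ X}

namespace OneSidedTransformation

variable (D : OneSidedTransformation F G)

/-- The naturality constraint of the unit `x ↦ Φ (𝟙 (F x))`: both sides are isomorphic to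
`Φ (F f)`, by `left` and by `right`. -/
def unitCell {x y : X} (f : x ⟶ y) :
    f ≫ (D.Φ y (F.obj y)).obj (𝟙 (F.obj y)) ≅
      (D.Φ x (F.obj x)).obj (𝟙 (F.obj x)) ≫ G.map (F.map f) :=
  (D.left f (𝟙 (F.obj y))).symm ≪≫
    (D.Φ x (F.obj y)).mapIso (ρ_ (F.map f) ≪≫ (λ_ (F.map f)).symm) ≪≫
      D.right (𝟙 (F.obj x)) (F.map f)

/-- The defining property of `unitCell`, without inverses. -/
theorem left_unitCell {x y : X} (f : x ⟶ y) :
    (D.left f (𝟙 (F.obj y))).hom ≫ (D.unitCell f).hom =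
      (D.Φ x (F.obj y)).map ((ρ_ (F.map f)).hom ≫ (λ_ (F.map f)).inv) ≫
        (D.right (𝟙 (F.obj x)) (F.map f)).hom := by
  simp only [unitCell, Iso.trans_hom, Iso.symm_hom, Iso.hom_inv_id_assoc, Functor.mapIso_hom]

theorem unitCell_naturality {x y : X} {f g : x ⟶ y} (β : f ⟶ g) :
    β ▷ (D.Φ y (F.obj y)).obj (𝟙 (F.obj y)) ≫ (D.unitCell g).hom =
      (D.unitCell f).hom ≫ (D.Φ x (F.obj x)).obj (𝟙 (F.obj x)) ◁ G.map₂ (F.map₂ β) := by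
  rw [← cancel_epi (D.left f (𝟙 (F.obj y))).hom]
  rw [← reassoc_of% D.left_naturality_left, left_unitCell, reassoc_of% (left_unitCell D),
    ← D.right_naturality_right]
  simp only [← Functor.map_comp_assoc]
  congr 2
  simp

theorem unitCell_id (x : X) :
    (D.unitCell (𝟙 x)).hom ≫
        (D.Φ x (F.obj x)).obj (𝟙 (F.obj x)) ◁ (G.map₂ (F.mapId x).hom ≫ (G.mapId (F.obj x)).hom) =
      (λ_ ((D.Φ x (F.obj x)).obj (𝟙 (F.obj x)))).hom ≫
        (ρ_ ((D.Φ x (F.obj x)).obj (𝟙 (F.obj x)))).inv := by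
  have hr := D.right_id (𝟙 (F.obj x))
  have hl := D.left_id (𝟙 (F.obj x))
  rw [← cancel_epi (D.left (𝟙 x) (𝟙 (F.obj x))).hom,
    ← cancel_mono (ρ_ ((D.Φ x (F.obj x)).obj (𝟙 (F.obj x)))).hom]
  simp only [whiskerLeft_comp, Category.assoc, reassoc_of% (left_unitCell D), Iso.inv_hom_id,
    Category.comp_id, hl]
  rw [← reassoc_of% D.right_naturality_right, hr]
  simp only [← Functor.map_comp]
  congr 1
  simp [unitors_equal]

theorem unitCell_comp {x y z : X} (f : x ⟶ y) (g : y ⟶ z) :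
    (D.unitCell (f ≫ g)).hom ≫
        (D.Φ x (F.obj x)).obj (𝟙 (F.obj x)) ◁
          (G.map₂ (F.mapComp f g).hom ≫ (G.mapComp (F.map f) (F.map g)).hom) =
      (α_ _ _ _).hom ≫ f ◁ (D.unitCell g).hom ≫ (α_ _ _ _).inv ≫
        (D.unitCell f).hom ▷ G.map (F.map g) ≫ (α_ _ _ _).hom := by
  have hr := D.right_comp (𝟙 (F.obj x)) (F.map f) (F.map g)
  -- The law `left_right`, solved for the side on which `left` comes first.
  have hlr : (D.left f (𝟙 (F.obj y) ≫ F.map g)).hom ≫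
      f ◁ (D.right (𝟙 (F.obj y)) (F.map g)).hom ≫ (α_ _ _ _).inv =
      (D.Φ x (F.obj z)).map (α_ _ _ _).inv ≫ (D.right (F.map f ≫ 𝟙 _) (F.map g)).hom ≫
        (D.left f (𝟙 (F.obj y))).hom ▷ G.map (F.map g) := by
    rw [← cancel_epi ((D.Φ x (F.obj z)).map (α_ (F.map f) (𝟙 (F.obj y)) (F.map g)).hom),
      reassoc_of% D.left_right, ← Functor.map_comp_assoc]
    simp
  rw [← cancel_epi (D.left (f ≫ g) (𝟙 (F.obj z))).hom, ← cancel_mono (α_ _ _ _).inv]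
  simp only [whiskerLeft_comp, Category.assoc, reassoc_of% (left_unitCell D), Iso.hom_inv_id,
    Category.comp_id]
  rw [← reassoc_of% D.right_naturality_right, hr, reassoc_of% D.left_comp, ← whiskerLeft_comp_assoc,
    left_unitCell, whiskerLeft_comp, Category.assoc, ← reassoc_of% D.left_naturality_right,
    reassoc_of% hlr, ← comp_whiskerRight, left_unitCell, comp_whiskerRight,
    ← reassoc_of% D.right_naturality_left]
  simp only [← Functor.map_comp_assoc]
  congr 2
  bicategory

/-- The unit `𝟭 ⇒ G F`, with components `Φ (𝟙 (F x))`. -/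
def unit : Pseudofunctor.StrongTrans (Pseudofunctor.id X) (F.comp G) where
  app x := (D.Φ x (F.obj x)).obj (𝟙 (F.obj x))
  naturality f := D.unitCell f
  naturality_naturality β := D.unitCell_naturality β
  -- In both laws the remaining difference is a whiskered identity, the constraint of `𝟭`.
  naturality_id x := by
    refine (D.unitCell_id x).trans ?_
    exact ((congrArg (· ≫ _) (id_whiskerRight _ _)).trans (Category.id_comp _)).symm
  naturality_comp {x y z} f g := by
    refine (D.unitCell_comp f g).trans ?_
    exact ((congrArg (· ≫ _) (id_whiskerRight _ _)).trans (Category.id_comp _)).symm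

/-- The component `Φ x a` is recovered from the unit: `Φ h ≅ Φ (𝟙 ≫ h) ≅ Φ 𝟙 ≫ G h`. -/
def arrowFunctorUnitIso (x : X) (a : A) :
    D.Φ x a ≅ arrowFunctor G ((D.Φ x (F.obj x)).obj (𝟙 (F.obj x))) a :=
  NatIso.ofComponents (fun h => (D.Φ x a).mapIso (λ_ h).symm ≪≫ D.right (𝟙 (F.obj x)) h)
    (fun {h k} β => by
      change (D.Φ x a).map β ≫ (D.Φ x a).map (λ_ k).inv ≫ (D.right (𝟙 (F.obj x)) k).hom =
        ((D.Φ x a).map (λ_ h).inv ≫ (D.right (𝟙 (F.obj x)) h).hom) ≫ _ ◁ G.map₂ β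
      rw [Category.assoc, ← D.right_naturality_right, ← Functor.map_comp_assoc,
        leftUnitor_inv_naturality, Functor.map_comp_assoc])

end OneSidedTransformation

/-! ### The one-sided transformation of a pseudo natural transformation `1 ⇒ G F` -/

section OfUnit

variable (η : Pseudofunctor.StrongTrans (Pseudofunctor.id X) (F.comp G))

/-- The component of `η` at `x`, with its domain and codomain evaluated. -/
def unitArrow (x : X) : x ⟶ G.obj (F.obj x) := η.app x

/-- The naturality constraint of `η` at `f`, with its domain and codomain evaluated. -/
def unitSquare {x y : X} (f : x ⟶ y) : f ≫ unitArrow η y ≅ unitArrow η x ≫ G.map (F.map f) :=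
  η.naturality f

theorem unitSquare_inv_naturality {x y : X} {f g : x ⟶ y} (β : f ⟶ g) :
    unitArrow η x ◁ G.map₂ (F.map₂ β) ≫ (unitSquare η g).inv =
      (unitSquare η f).inv ≫ β ▷ unitArrow η y := by
  have : β ▷ unitArrow η y ≫ (unitSquare η g).hom =
      (unitSquare η f).hom ≫ unitArrow η x ◁ G.map₂ (F.map₂ β) := η.naturality_naturality β
  rw [Iso.comp_inv_eq, Category.assoc, this, Iso.inv_hom_id_assoc]

theorem unitSquare_id_inv (x : X) :
    (unitSquare η (𝟙 x)).inv ≫ (λ_ _).hom =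
      unitArrow η x ◁ (G.map₂ (F.mapId x).hom ≫ (G.mapId (F.obj x)).hom) ≫ (ρ_ _).hom := by
  have h : (unitSquare η (𝟙 x)).hom ≫
      unitArrow η x ◁ (G.map₂ (F.mapId x).hom ≫ (G.mapId (F.obj x)).hom) =
      𝟙 (𝟙 x) ▷ unitArrow η x ≫ (λ_ (unitArrow η x)).hom ≫ (ρ_ (unitArrow η x)).inv :=
    η.naturality_id x
  rw [Iso.inv_comp_eq, reassoc_of% h]
  simp

theorem unitSquare_comp_inv {x y z : X} (f : x ⟶ y) (g : y ⟶ z) :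
    (unitSquare η (f ≫ g)).inv =
      unitArrow η x ◁ (G.map₂ (F.mapComp f g).hom ≫ (G.mapComp (F.map f) (F.map g)).hom) ≫
        (α_ _ _ _).inv ≫ (unitSquare η f).inv ▷ G.map (F.map g) ≫ (α_ _ _ _).hom ≫
          f ◁ (unitSquare η g).inv ≫ (α_ _ _ _).inv := by
  have h : (unitSquare η (f ≫ g)).hom ≫
        unitArrow η x ◁ (G.map₂ (F.mapComp f g).hom ≫ (G.mapComp (F.map f) (F.map g)).hom) =
      𝟙 (f ≫ g) ▷ unitArrow η z ≫ (α_ _ _ _).hom ≫ f ◁ (unitSquare η g).hom ≫ (α_ _ _ _).inv ≫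
        (unitSquare η f).hom ▷ G.map (F.map g) ≫ (α_ _ _ _).hom := η.naturality_comp f g
  rw [← cancel_epi (unitSquare η (f ≫ g)).hom, reassoc_of% h]
  simp

/-- 2-cells below the constraint of `η` can be moved across it. -/
theorem unitSquare_inv_exchange {x y : X} (f : x ⟶ y) {c : X} {p q : G.obj (F.obj y) ⟶ c}
    (θ : p ⟶ q) :
    (unitSquare η f).inv ▷ p ≫ (α_ _ _ _).hom ≫ f ◁ unitArrow η y ◁ θ =
      (α_ _ _ _).hom ≫ unitArrow η x ◁ G.map (F.map f) ◁ θ ≫ (α_ _ _ _).inv ≫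
        (unitSquare η f).inv ▷ q ≫ (α_ _ _ _).hom := by
  rw [← associator_naturality_right, ← whisker_exchange_assoc]
  simp

/-- The constraint `η ≫ G(F f ≫ h) ≅ f ≫ η ≫ G h`, from the naturality of `η`. -/
def unitLeft {x' x : X} {a : A} (f : x' ⟶ x) (h : F.obj x ⟶ a) :
    unitArrow η x' ≫ G.map (F.map f ≫ h) ≅ f ≫ unitArrow η x ≫ G.map h :=
  whiskerLeftIso (unitArrow η x') (G.mapComp (F.map f) h) ≪≫
    (α_ _ _ _).symm ≪≫ whiskerRightIso (unitSquare η f).symm (G.map h) ≪≫ α_ _ _ _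

theorem unitLeft_hom {x' x : X} {a : A} (f : x' ⟶ x) (h : F.obj x ⟶ a) :
    (unitLeft η f h).hom = unitArrow η x' ◁ (G.mapComp (F.map f) h).hom ≫
      (α_ _ _ _).inv ≫ (unitSquare η f).inv ▷ G.map h ≫ (α_ _ _ _).hom :=
  rfl

/-- The constraint `η ≫ G(h ≫ g) ≅ (η ≫ G h) ≫ G g`, from the functoriality of `G`. -/
def unitRight {x : X} {a a' : A} (h : F.obj x ⟶ a) (g : a ⟶ a') :
    unitArrow η x ≫ G.map (h ≫ g) ≅ (unitArrow η x ≫ G.map h) ≫ G.map g :=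
  whiskerLeftIso (unitArrow η x) (G.mapComp h g) ≪≫ (α_ _ _ _).symm

theorem unitRight_hom {x : X} {a a' : A} (h : F.obj x ⟶ a) (g : a ⟶ a') :
    (unitRight η h g).hom = unitArrow η x ◁ (G.mapComp h g).hom ≫ (α_ _ _ _).inv :=
  rfl

theorem unitLeft_naturality_left {x' x : X} {a : A} {f f' : x' ⟶ x} (β : f ⟶ f')
    (h : F.obj x ⟶ a) :
    unitArrow η x' ◁ G.map₂ (F.map₂ β ▷ h) ≫ (unitLeft η f' h).hom =
      (unitLeft η f h).hom ≫ β ▷ (unitArrow η x ≫ G.map h) := by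
  have := congrArg (fun t => t ▷ G.map h) (unitSquare_inv_naturality η β)
  simp only [comp_whiskerRight] at this
  simp only [unitLeft_hom, G.map₂_whisker_right, whiskerLeft_comp, Category.assoc,
    whiskerLeft_inv_hom_assoc]
  rw [associator_inv_naturality_middle_assoc, reassoc_of% this, associator_naturality_left]

theorem unitLeft_naturality_right {x' x : X} {a : A} (f : x' ⟶ x) {h k : F.obj x ⟶ a}
    (β : h ⟶ k) :
    unitArrow η x' ◁ G.map₂ (F.map f ◁ β) ≫ (unitLeft η f k).hom =
      (unitLeft η f h).hom ≫ f ◁ unitArrow η x ◁ G.map₂ β := by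
  simp only [unitLeft_hom, G.map₂_whisker_left, whiskerLeft_comp, Category.assoc,
    whiskerLeft_inv_hom_assoc, unitSquare_inv_exchange, Iso.inv_hom_id_assoc]

theorem unitRight_naturality_left {x : X} {a a' : A} {h k : F.obj x ⟶ a} (β : h ⟶ k)
    (g : a ⟶ a') :
    unitArrow η x ◁ G.map₂ (β ▷ g) ≫ (unitRight η k g).hom =
      (unitRight η h g).hom ≫ (unitArrow η x ◁ G.map₂ β) ▷ G.map g := by
  simp [unitRight_hom]

theorem unitRight_naturality_right {x : X} {a a' : A} (h : F.obj x ⟶ a) {g g' : a ⟶ a'}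
    (θ : g ⟶ g') :
    unitArrow η x ◁ G.map₂ (h ◁ θ) ≫ (unitRight η h g').hom =
      (unitRight η h g).hom ≫ (unitArrow η x ≫ G.map h) ◁ G.map₂ θ := by
  simp [unitRight_hom]

theorem unitLeft_id {x : X} {a : A} (h : F.obj x ⟶ a) :
    (unitLeft η (𝟙 x) h).hom ≫ (λ_ _).hom =
      unitArrow η x ◁ G.map₂ ((F.mapId x).hom ▷ h ≫ (λ_ h).hom) := by
  have := congrArg (fun t => t ▷ G.map h) (unitSquare_id_inv η x)
  simp only [comp_whiskerRight] at this
  calc _ = unitArrow η x ◁ (G.mapComp (F.map (𝟙 x)) h).hom ≫ (α_ _ _ _).inv ≫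
        (unitSquare η (𝟙 x)).inv ▷ G.map h ≫ (λ_ _).hom ▷ G.map h := by
        rw [unitLeft_hom]
        bicategory
    _ = _ := by
        rw [this]
        simp only [G.map₂_comp, G.map₂_whisker_right, G.map₂_left_unitor, Category.assoc,
          Iso.inv_hom_id_assoc]
        bicategory

theorem unitRight_id {x : X} {a : A} (h : F.obj x ⟶ a) :
    (unitRight η h (𝟙 a)).hom ≫ (unitArrow η x ≫ G.map h) ◁ (G.mapId a).hom ≫ (ρ_ _).hom =
      unitArrow η x ◁ G.map₂ (ρ_ h).hom := by
  simp [unitRight_hom]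

theorem unitLeft_comp {x'' x' x : X} {a : A} (f' : x'' ⟶ x') (f : x' ⟶ x) (h : F.obj x ⟶ a) :
    (unitLeft η (f' ≫ f) h).hom ≫ (α_ _ _ _).hom =
      unitArrow η x'' ◁ G.map₂ ((F.mapComp f' f).hom ▷ h ≫ (α_ _ _ _).hom) ≫
        (unitLeft η f' (F.map f ≫ h)).hom ≫ f' ◁ (unitLeft η f h).hom := by
  simp only [unitLeft_hom, whiskerLeft_comp f', reassoc_of% (unitSquare_inv_exchange η),
    unitSquare_comp_inv,
    G.map₂_comp, G.map₂_whisker_right, G.map₂_associator, Category.assoc, Iso.inv_hom_id_assoc,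
    whiskerLeft_comp (unitArrow η x''), whiskerLeft_inv_hom_assoc,
    whiskerLeft_whiskerLeft_inv_hom_assoc]
  bicategory

theorem unitRight_comp {x : X} {a a' a'' : A} (h : F.obj x ⟶ a) (g : a ⟶ a') (g' : a' ⟶ a'') :
    (unitRight η h (g ≫ g')).hom ≫ (unitArrow η x ≫ G.map h) ◁ (G.mapComp g g').hom ≫
        (α_ _ _ _).inv =
      unitArrow η x ◁ G.map₂ (α_ h g g').inv ≫ (unitRight η (h ≫ g) g').hom ≫
        (unitRight η h g).hom ▷ G.map g' := by
  calc _ = unitArrow η x ◁ ((G.mapComp h (g ≫ g')).hom ≫ G.map h ◁ (G.mapComp g g').hom) ≫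
        (α_ _ _ _).inv ≫ (α_ _ _ _).inv := by
        rw [unitRight_hom]
        bicategory
    _ = _ := by
        rw [G.mapComp_assoc_right_hom, unitRight_hom, unitRight_hom]
        bicategory

theorem unitLeft_unitRight {x' x : X} {a a' : A} (f : x' ⟶ x) (h : F.obj x ⟶ a) (g : a ⟶ a') :
    unitArrow η x' ◁ G.map₂ (α_ (F.map f) h g).hom ≫ (unitLeft η f (h ≫ g)).hom ≫
        f ◁ (unitRight η h g).hom =
      (unitRight η (F.map f ≫ h) g).hom ≫ (unitLeft η f h).hom ▷ G.map g ≫ (α_ _ _ _).hom := by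
  simp only [unitLeft_hom, unitRight_hom, whiskerLeft_comp f,
    reassoc_of% (unitSquare_inv_exchange η),
    G.map₂_associator, Category.assoc, Iso.inv_hom_id_assoc, whiskerLeft_comp (unitArrow η x'),
    whiskerLeft_inv_hom_assoc, whiskerLeft_whiskerLeft_inv_hom_assoc]
  bicategory

/-- The one-sided transformation `h ↦ η ≫ G h`. -/
def OneSidedTransformation.ofUnit : OneSidedTransformation F G where
  Φ x a := arrowFunctor G (unitArrow η x) a
  left := unitLeft η
  right := unitRight η
  left_naturality_left := unitLeft_naturality_left η
  left_naturality_right := unitLeft_naturality_right η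
  right_naturality_left := unitRight_naturality_left η
  right_naturality_right := unitRight_naturality_right η
  left_id := unitLeft_id η
  right_id := unitRight_id η
  left_comp := unitLeft_comp η
  right_comp := unitRight_comp η
  left_right := unitLeft_unitRight η

end OfUnit

end Unit

end Biadj

theorem mainTheorem5
    {X : Type u₁} [CategoryTheory.Bicategory.{w, v} X] [CategoryTheory.Bicategory.Strict X]
    {A : Type u₂} [CategoryTheory.Bicategory.{w, v} A] [CategoryTheory.Bicategory.Strict A]
    (F : CategoryTheory.Pseudofunctor X A) (G : CategoryTheory.Pseudofunctor A X) :
    Biadj.IsLeftBiadjoint F G ↔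
      ∃ η : CategoryTheory.Pseudofunctor.StrongTrans
          (CategoryTheory.Pseudofunctor.id X) (F.comp G),
        ∀ x : X, Biadj.IsBiuniversalArrow G (r := F.obj x) (η.app x) := by
  constructor
  · rintro ⟨φ, hφ⟩
    refine ⟨(Biadj.Transformation.toOneSided φ).unit, fun x a => ?_⟩
    exact @CategoryTheory.Functor.isEquivalence_of_iso _ _ _ _ _ _
      ((Biadj.Transformation.toOneSided φ).arrowFunctorUnitIso x a) (hφ x a)
  · rintro ⟨η, hη⟩
    exact ⟨(Biadj.OneSidedTransformation.ofUnit η).toStrongTrans, fun x a => hη x a⟩
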